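/- \textbf{Setting.} Let $\mathcal X\subset\mathbb R^p$ be a compact set. Let the original feature $X$ and the synthetic feature $\widetilde X$ have probability densities $\mathbb P_X$ and $\mathbb P_{\widetilde X}$ with respect to Lebesgue measure, both vanishing outside $\mathcal X$. Let $\beta^*\in\mathbb R^p$ and let $B$ be a constant with $\|\beta^*\|_\infty<B/2$. For $\beta\in\mathbb R^p$ put $\eta_\beta(x)=1/(1+\exp(-x^T\beta))$. The original data set $\mathcal D_n=\{(x_i,z_i)\}_{i=1}^n$ is an i.i.d. sample of $(X,Z)$, where $Z\in\{-1,1\}$ and $\mathbb P(Z=1\mid X=x)=\eta_{\beta^*}(x)$. Let $$\widehat\beta\in\mathop{\mathrm{argmin}}_{\beta\in\mathbb R^p}\frac1n\sum_{i=1}^n\log\bigl(1+\exp(-z_ix_i^T\beta)\bigr)$$ be the maximum likelihood estimator computed from $\mathcal D_n$; on data sets for which no minimizer exists, $\widehat\beta$ may take any (measurable) value. Conditionally on $\mathcal D_n$, the synthetic data set $\widetilde{\mathcal D}=\{(\widetilde x_j,\widetilde z_j)\}_{j=1}^{\widetilde n}$ consists of i.i.d. pairs with $\widetilde x_j$ distributed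 as $\widetilde X$ and $\widetilde z_j\in\{-1,1\}$, $\mathbb P(\widetilde z_j=1\mid \widetilde x_j)=\eta_{\widehat\beta}(\widetilde x_j)$. Let $\mathcal G=\{x\mapsto x^T\beta:\beta\in[-B,B]^p\}$ and let $$\widehat g_{\log}\in\mathop{\mathrm{argmin}}_{g\in\mathcal G}\frac1n\sum_{i=1}^n\log\bigl(1+\exp(-z_ig(x_i))\bigr),\qquad \widetilde g_{\log}\in\mathop{\mathrm{argmin}}_{g\in\mathcal G}\frac1{\widetilde n}\sum_{j=1}^{\widetilde n}\log\bigl(1+\exp(-\widetilde z_jg(\widetilde x_j))\bigr).$$ Write $R_{0\text{-}1}(g)=\mathbb P(\mathrm{sign}(g(X))\neq Z)$ (with $\mathrm{sign}(0)=0$) and $U_c(\widetilde g,\widehat g)=|R_{0\text{-}1}(\widetilde g)-R_{0\text{-}1}(\widehat g)|$. \textbf{Theorem.} Suppose that there is a constant $C_1>0$ with $\mathbb P_{\widetilde X}(x)\le C_1\,\mathbb P_X(x)$ for all $x\in\mathcal X$. Then for every $\delta>0$, $$\lim_{n\to\infty}\ \limsup_{\widetilde n\to\infty}\ \mathbb P\bigl(U_c(\widetilde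 g_{\log},\widehat g_{\log})>\delta\bigr)=0 .$$ In particular, $\lim_{n\to\infty}\lim_{\widetilde n\to\infty}\mathbb P(U_c(\widetilde g_{\log},\widehat g_{\log})>\delta)=0$ whenever the inner limits exist. The distributions of $X$ and $\widetilde X$ are not required to agree. -/

import Mathlib

open MeasureTheory ProbabilityTheory Filter Topology
open scoped ENNReal Matrix

/-- A feature vector in `ℝ^p`; the norm `‖·‖` on this type is the sup norm. -/
abbrev Feature (p : ℕ) : Type := Fin p → ℝ

/-- A labelled sample `(x, z)`; all laws below are concentrated on labels `z ∈ {-1, 1}`. -/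
abbrev Sample (p : ℕ) : Type := Feature p × ℝ

/-- A data set of `n` labelled samples. -/
abbrev Dataset (p n : ℕ) : Type := Fin n → Sample p

/-- `f` is a probability density function of `μ` with respect to Lebesgue measure, and it
vanishes outside `𝒳`. -/
structure HasDensityOn {p : ℕ} (μ : Measure (Feature p)) (𝒳 : Set (Feature p))
    (f : Feature p → ℝ) : Prop where
  measurable : Measurable f
  nonneg : ∀ x, 0 ≤ f x
  eq_zero_of_notMem : ∀ x, x ∉ 𝒳 → f x = 0
  eq_withDensity : μ = volume.withDensity fun x => ENNReal.ofReal (f x)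

/-- The logistic regression function `η_β(x) = 1 / (1 + exp(-xᵀβ))`. -/
noncomputable def logisticProb {p : ℕ} (β x : Feature p) : ℝ :=
  1 / (1 + Real.exp (-(x ⬝ᵥ β)))

/-- The law of `(X, Z)` where `X ∼ μ` and, given `X = x`, `Z = 1` with probability `η_β(x)` and
`Z = -1` with probability `1 - η_β(x)`. -/
noncomputable def logisticLaw {p : ℕ} (μ : Measure (Feature p)) (β : Feature p) :
    Measure (Sample p) :=
  (μ.withDensity fun x => ENNReal.ofReal (logisticProb β x)).map (fun x => (x, (1 : ℝ))) +
    (μ.withDensity fun x => ENNReal.ofReal (1 - logisticProb β x)).map (fun x => (x, (-1 : ℝ)))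

/-- The law of `n` independent samples from `Q`. -/
noncomputable def iidLaw {p : ℕ} (Q : Measure (Sample p)) (n : ℕ) : Measure (Dataset p n) :=
  Measure.pi fun _ => Q

/-- The empirical logistic risk `(1/n) ∑ᵢ log(1 + exp(-zᵢ g(xᵢ)))`. -/
noncomputable def empLogisticRisk {p n : ℕ} (D : Dataset p n) (g : Feature p → ℝ) : ℝ :=
  (1 / (n : ℝ)) * ∑ i, Real.log (1 + Real.exp (-((D i).2 * g (D i).1)))

/-- The linear function `x ↦ xᵀβ`. -/
def linearScore {p : ℕ} (β : Feature p) : Feature p → ℝ := fun x => x ⬝ᵥ β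

/-- The class `{x ↦ xᵀβ : β ∈ [-B, B]^p}`. -/
def boundedLinearClass (p : ℕ) (B : ℝ) : Set (Feature p → ℝ) :=
  {g | ∃ β : Feature p, (∀ i, β i ∈ Set.Icc (-B) B) ∧ g = linearScore β}

/-- `β` is a maximum likelihood estimate from `D`: a minimizer of the empirical logistic risk over
all of `ℝ^p`. -/
def IsLogisticMLE {p n : ℕ} (D : Dataset p n) (β : Feature p) : Prop :=
  ∀ β' : Feature p, empLogisticRisk D (linearScore β) ≤ empLogisticRisk D (linearScore β')

/-- `g` minimizes the empirical logistic risk over the class `G`. -/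
def IsLogisticERM {p n : ℕ} (G : Set (Feature p → ℝ)) (D : Dataset p n)
    (g : Feature p → ℝ) : Prop :=
  g ∈ G ∧ ∀ h ∈ G, empLogisticRisk D g ≤ empLogisticRisk D h

/-- The 0-1 risk `P(sign(g(X)) ≠ Z)` for `(X, Z) ∼ Q`. -/
noncomputable def zeroOneRisk {p : ℕ} (Q : Measure (Sample p)) (g : Feature p → ℝ) : ℝ :=
  Q.real {q | Real.sign (g q.1) ≠ q.2}

/-- The utility metric `|R₀₁(g̃) - R₀₁(ĝ)|`, with risks taken under `Q`. -/
noncomputable def classUtility {p : ℕ} (Q : Measure (Sample p)) (g₁ g₂ : Feature p → ℝ) : ℝ :=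
  |zeroOneRisk Q g₁ - zeroOneRisk Q g₂|

theorem logisticProb_pos {p : ℕ} (β x : Feature p) : 0 < logisticProb β x := by
  unfold logisticProb; positivity

theorem logisticProb_le_one {p : ℕ} (β x : Feature p) : logisticProb β x ≤ 1 := by
  unfold logisticProb
  rw [div_le_one (by positivity)]
  linarith [Real.exp_pos (-(x ⬝ᵥ β))]

theorem measurable_logisticProb {p : ℕ} :
    Measurable fun q : Feature p × Feature p => logisticProb q.1 q.2 := by
  unfold logisticProb dotProduct
  fun_prop

theorem logisticLaw_apply {p : ℕ} (μ : Measure (Feature p)) (β : Feature p)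
    {s : Set (Sample p)} (hs : MeasurableSet s) :
    logisticLaw μ β s =
      (∫⁻ x, ((fun x => (x, (1 : ℝ))) ⁻¹' s).indicator
          (fun x => ENNReal.ofReal (logisticProb β x)) x ∂μ) +
        ∫⁻ x, ((fun x => (x, (-1 : ℝ))) ⁻¹' s).indicator
          (fun x => ENNReal.ofReal (1 - logisticProb β x)) x ∂μ := by
  have h1 : Measurable fun x : Feature p => (x, (1 : ℝ)) := by fun_prop
  have h2 : Measurable fun x : Feature p => (x, (-1 : ℝ)) := by fun_prop
  rw [logisticLaw, Measure.add_apply, Measure.map_apply h1 hs, Measure.map_apply h2 hs,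
    withDensity_apply _ (h1 hs), withDensity_apply _ (h2 hs), lintegral_indicator (h1 hs),
    lintegral_indicator (h2 hs)]

instance instIsProbabilityMeasureLogisticLaw {p : ℕ} (μ : Measure (Feature p))
    [IsProbabilityMeasure μ] (β : Feature p) :
    IsProbabilityMeasure (logisticLaw μ β) := by
  refine ⟨?_⟩
  have hm : Measurable fun x : Feature p => logisticProb β x := by
    unfold logisticProb dotProduct
    fun_prop
  rw [logisticLaw_apply μ β MeasurableSet.univ]
  simp only [Set.preimage_univ, Set.indicator_univ]
  rw [← lintegral_add_left (by fun_prop)]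
  have : ∀ x, ENNReal.ofReal (logisticProb β x) + ENNReal.ofReal (1 - logisticProb β x) = 1 := by
    intro x
    rw [← ENNReal.ofReal_add (logisticProb_pos β x).le
      (sub_nonneg.2 (logisticProb_le_one β x))]
    simp
  simp [this]

instance instIsProbabilityMeasureIidLaw {p : ℕ} (Q : Measure (Sample p))
    [IsProbabilityMeasure Q] (n : ℕ) :
    IsProbabilityMeasure (iidLaw Q n) := by
  unfold iidLaw; infer_instance

theorem measurable_logisticLaw {p : ℕ} (μ : Measure (Feature p)) [IsProbabilityMeasure μ] :
    Measurable fun β : Feature p => logisticLaw μ β := by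
  refine Measure.measurable_of_measurable_coe _ fun s hs => ?_
  simp only [logisticLaw_apply μ _ hs]
  have key : ∀ (c : ℝ) (F : Feature p × Feature p → ℝ≥0∞), Measurable F →
      Measurable fun β : Feature p =>
        ∫⁻ x, ((fun x => (x, c)) ⁻¹' s).indicator (fun x => F (β, x)) x ∂μ := by
    intro c F hF
    have ht : MeasurableSet ((fun q : Feature p × Feature p => (q.2, c)) ⁻¹' s) :=
      (show Measurable fun q : Feature p × Feature p => (q.2, c) by fun_prop) hs
    exact (hF.indicator ht).lintegral_prod_right'
  exact (key 1 (fun q => ENNReal.ofReal (logisticProb q.1 q.2))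
      measurable_logisticProb.ennreal_ofReal).add
    (key (-1) (fun q => ENNReal.ofReal (1 - logisticProb q.1 q.2))
      (measurable_const.sub measurable_logisticProb).ennreal_ofReal)

theorem measurable_iidLaw_logisticLaw {p : ℕ} (μ : Measure (Feature p))
    [IsProbabilityMeasure μ] (m : ℕ) :
    Measurable fun β : Feature p => iidLaw (logisticLaw μ β) m := by
  refine Measurable.measure_of_isPiSystem_of_isProbabilityMeasure generateFrom_pi.symm
    isPiSystem_pi ?_
  rintro _ ⟨s, hs, rfl⟩
  simp only [iidLaw, Measure.pi_pi]
  exact Finset.measurable_prod _ fun i _ =>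
    (Measure.measurable_coe (show MeasurableSet (s i) from hs i (Set.mem_univ i))).comp (measurable_logisticLaw μ)

/-- The synthetic data generator: given a coefficient vector `β`, it outputs `m` independent
samples `(x̃ⱼ, z̃ⱼ)` with `x̃ⱼ ∼ ν` and `z̃ⱼ = ±1` drawn from the logistic model `η_β(x̃ⱼ)`. -/
noncomputable def syntheticKernel {p : ℕ} (ν : Measure (Feature p)) [IsProbabilityMeasure ν]
    (m : ℕ) : Kernel (Feature p) (Dataset p m) where
  toFun β := iidLaw (logisticLaw ν β) m
  measurable' := measurable_iidLaw_logisticLaw ν m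

instance instIsMarkovKernelSyntheticKernel {p : ℕ} (ν : Measure (Feature p))
    [IsProbabilityMeasure ν] (m : ℕ) :
    IsMarkovKernel (syntheticKernel ν m) :=
  ⟨fun β => inferInstanceAs (IsProbabilityMeasure (iidLaw (logisticLaw ν β) m))⟩

/-- The joint law of the original data set `D` (of size `n`, i.i.d. from the logistic model with
features `μ` and coefficient `βstar`) and the synthetic data set of size `m`, which given `D` is
generated from features `ν` and the fitted coefficient `βhat D`. -/
noncomputable def jointLaw {p : ℕ} (μ ν : Measure (Feature p)) [IsProbabilityMeasure ν]
    (βstar : Feature p) (n m : ℕ) (βhat : Dataset p n → Feature p) (hβ : Measurable βhat) :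
    Measure (Dataset p n × Dataset p m) :=
  iidLaw (logisticLaw μ βstar) n ⊗ₘ (syntheticKernel ν m).comap βhat hβ

instance instIsProbabilityMeasureJointLaw {p : ℕ} (μ ν : Measure (Feature p))
    [IsProbabilityMeasure μ] [IsProbabilityMeasure ν] (βstar : Feature p) (n m : ℕ)
    (βhat : Dataset p n → Feature p) (hβ : Measurable βhat) :
    IsProbabilityMeasure (jointLaw μ ν βstar n m βhat hβ) := by
  unfold jointLaw; infer_instance

/-! Both downstream fits converge to `βstar`, and the 0-1 risk is continuous there when `βstar ≠ 0`.

Let data with features `ν` be generated by a coefficient `c`. The population logistic risk has the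
unique minimizer `c`: the loss lies strictly above its tangents, and hyperplanes are `ν`-null
(`excessRisk_pos`). By compactness there is a positive gap on every sphere about `c`. Chebyshev's
inequality on a finite net of the sphere and a Lipschitz bound carry the gap over to the empirical
risk, and convexity then confines every empirical minimizer, over `ℝ^p` or over the box, to the
ball. `exists_localization` does this with one exceptional event, of probability `O(1/m)` uniformly
over generating coefficients `β` near `c`.

This uniformity allows two applications about `βstar`. On the original data it makes the maximum
likelihood estimate exist and lie near `βstar`, and puts the coefficient of `ghat` there too. Given
such data, the synthetic sample has a generating coefficient near `βstar`, so `gtilde` is localized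
as well. The exceptional probability is at most `K/n + K'/m`.

If `βstar = 0`, continuity fails, but all nonzero linear classifiers have risk `1/2`, and the zero
classifier minimizes the empirical risk only on a null event. -/

/-! ### The scalar logistic loss -/

/-- The scalar logistic loss `log(1 + exp(-u))`. -/
noncomputable def logLoss (u : ℝ) : ℝ := Real.log (1 + Real.exp (-u))

theorem logLoss_nonneg (u : ℝ) : 0 ≤ logLoss u :=
  Real.log_nonneg (by linarith [Real.exp_pos (-u)])

theorem exp_logLoss (u : ℝ) : Real.exp (logLoss u) = 1 + Real.exp (-u) :=
  Real.exp_log (by positivity)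

theorem continuous_logLoss : Continuous logLoss :=
  (by fun_prop : Continuous fun u : ℝ => 1 + Real.exp (-u)).log fun u => by positivity

theorem measurable_logLoss : Measurable logLoss := continuous_logLoss.measurable

theorem logLoss_neg (u : ℝ) : logLoss (-u) = logLoss u + u := by
  apply Real.exp_injective
  rw [Real.exp_add, exp_logLoss, exp_logLoss, neg_neg, add_mul, ← Real.exp_add]
  simp [add_comm]

theorem hasDerivAt_logLoss (u : ℝ) :
    HasDerivAt logLoss (-(1 / (1 + Real.exp u))) u := by
  have h := (((hasDerivAt_neg u).exp).const_add 1).log (by positivity : 1 + Real.exp (-u) ≠ 0)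
  refine h.congr_deriv ?_
  rw [Real.exp_neg]
  field_simp
  ring

theorem logLoss_sub_le (u v : ℝ) : logLoss u - logLoss v ≤ |u - v| := by
  have : logLoss u ≤ |u - v| + logLoss v := by
    rw [← Real.exp_le_exp, Real.exp_add, exp_logLoss, exp_logLoss, mul_add, ← Real.exp_add]
    have h1 : 1 ≤ Real.exp |u - v| := Real.one_le_exp (abs_nonneg _)
    have h2 : Real.exp (-u) ≤ Real.exp (|u - v| + -v) :=
      Real.exp_le_exp.2 (by linarith [neg_abs_le (u - v)])
    linarith
  linarith

theorem abs_logLoss_sub_le (u v : ℝ) : |logLoss u - logLoss v| ≤ |u - v| :=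
  abs_le.2 ⟨by linarith [logLoss_sub_le v u, abs_sub_comm u v], logLoss_sub_le u v⟩

/-- The logistic loss lies strictly above its tangents. -/
theorem logLoss_tangent_lt {s t : ℝ} (h : s ≠ t) :
    logLoss s - 1 / (1 + Real.exp s) * (t - s) < logLoss t := by
  set c := 1 / (1 + Real.exp s) with hc
  have hs := Real.exp_pos s
  have hc0 : 0 < c := by positivity
  have hc1 : 0 < 1 - c := by
    rw [sub_pos, hc, div_lt_one (by positivity)]; linarith
  -- Strict convexity of `exp` between `s - t` and `0`, with weights `c` and `1 - c`. The factor `1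
  -- + exp(-s)` turns these weights into `exp(-s)` and `1`, so the right side becomes exactly `1 +
  -- exp(-t)`.
  have key := strictConvexOn_exp.2 (Set.mem_univ (s - t)) (Set.mem_univ (0 : ℝ))
    (sub_ne_zero.2 h) hc0 hc1 (by ring)
  simp only [smul_eq_mul, mul_zero, add_zero, Real.exp_zero, mul_one] at key
  rw [← Real.exp_lt_exp, exp_logLoss, sub_eq_add_neg, Real.exp_add, exp_logLoss]
  calc (1 + Real.exp (-s)) * Real.exp (-(c * (t - s)))
      = (1 + Real.exp (-s)) * Real.exp (c * (s - t)) := by ring_nf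
    _ < (1 + Real.exp (-s)) * (c * Real.exp (s - t) + (1 - c)) := by gcongr
    _ = 1 + Real.exp (-t) := by
      rw [hc, Real.exp_sub, Real.exp_neg, Real.exp_neg]
      have ht := Real.exp_pos t
      field_simp
      ring

theorem logLoss_tangent_le (s t : ℝ) :
    logLoss s - 1 / (1 + Real.exp s) * (t - s) ≤ logLoss t := by
  rcases eq_or_ne s t with rfl | h
  · simp
  · exact (logLoss_tangent_lt h).le

theorem convexOn_logLoss : ConvexOn ℝ Set.univ logLoss := by
  refine ⟨convex_univ, fun u _ v _ a b ha hb hab => ?_⟩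
  simp only [smul_eq_mul]
  set w := a * u + b * v with hw
  set c := 1 / (1 + Real.exp w)
  have h1 := mul_le_mul_of_nonneg_left (logLoss_tangent_le w u) ha
  have h2 := mul_le_mul_of_nonneg_left (logLoss_tangent_le w v) hb
  -- The tangent at the average `w` is affine, so the slope terms at `u` and `v` cancel in the
  -- weighted sum.
  have e : a * (logLoss w - c * (u - w)) + b * (logLoss w - c * (v - w)) = logLoss w := by
    have hb' : b = 1 - a := by linarith
    rw [hw, hb']; ring
  linarith

/-- Among all scores `t`, the true log-odds `s` is the unique minimizer of the conditional
logistic risk. -/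
theorem condLogisticRisk_lt {s t : ℝ} (h : s ≠ t) :
    1 / (1 + Real.exp (-s)) * logLoss s + (1 - 1 / (1 + Real.exp (-s))) * logLoss (-s) <
      1 / (1 + Real.exp (-s)) * logLoss t + (1 - 1 / (1 + Real.exp (-s))) * logLoss (-t) := by
  have e : 1 - 1 / (1 + Real.exp (-s)) = 1 / (1 + Real.exp s) := by
    rw [Real.exp_neg]
    have := Real.exp_pos s
    field_simp
    ring
  have e' : 1 / (1 + Real.exp (-s)) = 1 - 1 / (1 + Real.exp s) := by linarith
  -- Since `logLoss (-t) = logLoss t + t`, the conditional risk of `t` is `logLoss t + t / (1 + exp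
  -- s)`; the claim is the strict tangent inequality at `s`.
  rw [e, e', logLoss_neg, logLoss_neg]
  linarith [logLoss_tangent_lt h]

/-- Lets the sigmoid inherit a Lipschitz constant `1` from `logLoss`, because `exp` is 1-Lipschitz
on nonpositive arguments. -/
theorem sigmoid_eq_exp_neg_logLoss (s : ℝ) :
    1 / (1 + Real.exp (-s)) = Real.exp (-logLoss s) := by
  rw [Real.exp_neg (logLoss s), exp_logLoss, one_div]

theorem sigmoid_sub_le (s t : ℝ) :
    1 / (1 + Real.exp (-s)) - 1 / (1 + Real.exp (-t)) ≤ |s - t| := by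
  rw [sigmoid_eq_exp_neg_logLoss, sigmoid_eq_exp_neg_logLoss]
  have h1 := Real.add_one_le_exp (logLoss s - logLoss t)
  have h2 : Real.exp (-logLoss s) ≤ 1 := Real.exp_le_one_iff.2 (by linarith [logLoss_nonneg s])
  have h3 : Real.exp (-logLoss t) =
      Real.exp (-logLoss s) * Real.exp (logLoss s - logLoss t) := by
    rw [← Real.exp_add]; congr 1; ring
  have h4 := abs_logLoss_sub_le s t
  have h5 := (abs_le.1 h4).1
  have h0 := Real.exp_pos (-logLoss s)
  have h6 : Real.exp (-logLoss s) * (logLoss s - logLoss t + 1) ≤ Real.exp (-logLoss t) :=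
    h3 ▸ mul_le_mul_of_nonneg_left h1 h0.le
  have h7 : Real.exp (-logLoss s) * (logLoss t - logLoss s) ≤ 1 * |s - t| :=
    (mul_le_mul_of_nonneg_left (by linarith) h0.le).trans
      (mul_le_mul_of_nonneg_right h2 (abs_nonneg _))
  nlinarith

theorem abs_sigmoid_sub_le (s t : ℝ) :
    |1 / (1 + Real.exp (-s)) - 1 / (1 + Real.exp (-t))| ≤ |s - t| :=
  abs_le.2 ⟨by linarith [sigmoid_sub_le t s, abs_sub_comm s t], sigmoid_sub_le s t⟩

/-! ### The logistic loss of a linear score -/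

theorem abs_dotProduct_le {p : ℕ} (x b : Feature p) : |x ⬝ᵥ b| ≤ p * ‖x‖ * ‖b‖ := by
  unfold dotProduct
  calc |∑ i, x i * b i| ≤ ∑ i, |x i * b i| := Finset.abs_sum_le_sum_abs _ _
    _ ≤ ∑ _i : Fin p, ‖x‖ * ‖b‖ := Finset.sum_le_sum fun i _ => by
        rw [abs_mul]
        exact mul_le_mul (norm_le_pi_norm x i) (norm_le_pi_norm b i) (abs_nonneg _)
          (norm_nonneg _)
    _ = p * ‖x‖ * ‖b‖ := by simp [mul_assoc]

/-- The logistic loss `log(1 + exp(-z xᵀb))` of the linear score `x ↦ xᵀb` at `(x, z)`. -/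
noncomputable def linLoss {p : ℕ} (b : Feature p) (q : Sample p) : ℝ :=
  logLoss (q.2 * (q.1 ⬝ᵥ b))

theorem empLogisticRisk_linearScore {p n : ℕ} (D : Dataset p n) (b : Feature p) :
    empLogisticRisk D (linearScore b) = (1 / (n : ℝ)) * ∑ i, linLoss b (D i) := rfl

theorem measurable_linLoss {p : ℕ} (b : Feature p) : Measurable (linLoss b) := by
  unfold linLoss dotProduct
  exact measurable_logLoss.comp (by fun_prop)

theorem convexOn_empLogisticRisk {p n : ℕ} (D : Dataset p n) :
    ConvexOn ℝ Set.univ fun b : Feature p => empLogisticRisk D (linearScore b) := by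
  have h : ∀ q : Sample p, ConvexOn ℝ Set.univ fun b : Feature p => linLoss b q := by
    intro q
    refine ⟨convex_univ, fun u _ v _ a b ha hb hab => ?_⟩
    have := convexOn_logLoss.2 (Set.mem_univ (q.2 * (q.1 ⬝ᵥ u))) (Set.mem_univ (q.2 * (q.1 ⬝ᵥ v)))
      ha hb hab
    simp only [linLoss, dotProduct_add, dotProduct_smul, smul_eq_mul] at this ⊢
    convert this using 2
    ring
  refine ⟨convex_univ, fun u _ v _ a b ha hb hab => ?_⟩
  simp only [empLogisticRisk_linearScore, smul_eq_mul]
  have := Finset.sum_le_sum fun i (_ : i ∈ Finset.univ) =>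
    (h (D i)).2 (Set.mem_univ u) (Set.mem_univ v) ha hb hab
  simp only [smul_eq_mul, Finset.sum_add_distrib, ← Finset.mul_sum] at this
  calc _ ≤ (1 / (n : ℝ)) * (a * ∑ i, linLoss u (D i) + b * ∑ i, linLoss v (D i)) := by gcongr
    _ = _ := by ring

theorem continuous_empLogisticRisk {p n : ℕ} (D : Dataset p n) :
    Continuous fun b : Feature p => empLogisticRisk D (linearScore b) := by
  simp only [empLogisticRisk_linearScore]
  refine continuous_const.mul (continuous_finsetSum _ fun i _ => ?_)
  unfold linLoss dotProduct
  exact continuous_logLoss.comp (by fun_prop)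

theorem abs_linLoss_sub_le {p : ℕ} {M : ℝ} {q : Sample p} (hM : ‖q.1‖ ≤ M) (hq : |q.2| = 1)
    (b b' : Feature p) : |linLoss b q - linLoss b' q| ≤ p * M * ‖b - b'‖ := by
  refine (abs_logLoss_sub_le _ _).trans ?_
  rw [← mul_sub, ← dotProduct_sub, abs_mul, hq, one_mul]
  refine (abs_dotProduct_le _ _).trans ?_
  gcongr

theorem abs_logisticProb_sub_le {p : ℕ} {M : ℝ} {x : Feature p} (hM : ‖x‖ ≤ M)
    (b b' : Feature p) : |logisticProb b x - logisticProb b' x| ≤ p * M * ‖b - b'‖ := by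
  refine (abs_sigmoid_sub_le _ _).trans ?_
  rw [← dotProduct_sub]
  refine (abs_dotProduct_le _ _).trans ?_
  gcongr

/-! ### Minimizers of convex functions -/

/-- If a convex function is larger on a sphere than at its centre, its sublevel set at the value
of the centre lies in the ball. -/
theorem ConvexOn.norm_sub_lt_of_lt_on_sphere {E : Type*} [NormedAddCommGroup E] [NormedSpace ℝ E]
    {F : E → ℝ} (hF : ConvexOn ℝ Set.univ F) {c b : E} {r : ℝ} (hr : 0 < r)
    (hs : ∀ u, ‖u - c‖ = r → F c < F u) (hb : F b ≤ F c) : ‖b - c‖ < r := by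
  by_contra! hle
  have hpos : 0 < ‖b - c‖ := hr.trans_le hle
  set t := r / ‖b - c‖ with ht
  have ht0 : 0 < t := by positivity
  have ht1 : t ≤ 1 := (div_le_one hpos).2 hle
  have h1 := hF.2 (Set.mem_univ c) (Set.mem_univ b) (sub_nonneg.2 ht1) ht0.le (by ring)
  -- The segment from `c` to `b` meets the sphere at parameter `t = r / ‖b - c‖`. Convexity bounds
  -- the value there by `F c`, against `hs`.
  have h2 := hs ((1 - t) • c + t • b) (by
    have : (1 - t) • c + t • b - c = t • (b - c) := by module
    rw [this, norm_smul, Real.norm_of_nonneg ht0.le, ht]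
    field_simp)
  simp only [smul_eq_mul] at h1
  nlinarith

/-- The minimum over the closed ball is global, since points outside have values above `F c`. This
supplies the existence of the maximum likelihood estimate. -/
theorem ConvexOn.exists_forall_le_of_lt_on_sphere {E : Type*} [NormedAddCommGroup E]
    [NormedSpace ℝ E] [ProperSpace E] {F : E → ℝ} (hF : ConvexOn ℝ Set.univ F)
    (hc : Continuous F) {c : E} {r : ℝ} (hr : 0 < r) (hs : ∀ u, ‖u - c‖ = r → F c < F u) :
    ∃ b, ∀ u, F b ≤ F u := by
  obtain ⟨b, -, hb⟩ := (isCompact_closedBall c r).exists_isMinOn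
    ⟨c, Metric.mem_closedBall_self hr.le⟩ hc.continuousOn
  refine ⟨b, fun u => ?_⟩
  by_cases hu : F u ≤ F c
  · exact hb (mem_closedBall_iff_norm.2 (hF.norm_sub_lt_of_lt_on_sphere hr hs hu).le)
  · exact (hb (Metric.mem_closedBall_self hr.le)).trans (not_le.1 hu).le

/-! ### Integration against the logistic law -/

theorem measurable_logisticProb_right {p : ℕ} (β : Feature p) : Measurable (logisticProb β) := by
  unfold logisticProb dotProduct
  fun_prop

theorem ae_logisticLaw {p : ℕ} {ν : Measure (Feature p)} {β : Feature p} {P : Sample p → Prop}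
    (hP : MeasurableSet {q | P q}) (h1 : ∀ᵐ x ∂ν, P (x, 1)) (h2 : ∀ᵐ x ∂ν, P (x, -1)) :
    ∀ᵐ q ∂logisticLaw ν β, P q := by
  rw [logisticLaw, ae_add_measure_iff, ae_map_iff (by fun_prop) hP, ae_map_iff (by fun_prop) hP]
  exact ⟨(withDensity_absolutelyContinuous _ _).ae_le h1,
    (withDensity_absolutelyContinuous _ _).ae_le h2⟩

theorem integral_logisticLaw {p : ℕ} (ν : Measure (Feature p)) [IsProbabilityMeasure ν]
    (β : Feature p) {φ : Sample p → ℝ} (hφ : Measurable φ) {C : ℝ}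
    (h1 : ∀ᵐ x ∂ν, |φ (x, 1)| ≤ C) (h2 : ∀ᵐ x ∂ν, |φ (x, -1)| ≤ C) :
    ∫ q, φ q ∂logisticLaw ν β =
      ∫ x, (logisticProb β x * φ (x, 1) + (1 - logisticProb β x) * φ (x, -1)) ∂ν := by
  have hint : Integrable φ (logisticLaw ν β) :=
    Integrable.of_bound hφ.aestronglyMeasurable C
      (ae_logisticLaw (measurableSet_le hφ.norm measurable_const) h1 h2)
  have hη := measurable_logisticProb_right β
  have m1 : Measurable fun x : Feature p => φ (x, (1 : ℝ)) := hφ.comp (by fun_prop)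
  have m2 : Measurable fun x : Feature p => φ (x, (-1 : ℝ)) := hφ.comp (by fun_prop)
  have i1 : Integrable (fun x => logisticProb β x * φ (x, 1)) ν := by
    refine Integrable.of_bound (hη.mul m1).aestronglyMeasurable C ?_
    filter_upwards [h1] with x hx
    rw [norm_mul, Real.norm_of_nonneg (logisticProb_pos β x).le]
    exact (mul_le_of_le_one_left (norm_nonneg _) (logisticProb_le_one β x)).trans hx
  have i2 : Integrable (fun x => (1 - logisticProb β x) * φ (x, -1)) ν := by
    refine Integrable.of_bound ((measurable_const.sub hη).mul m2).aestronglyMeasurable C ?_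
    filter_upwards [h2] with x hx
    rw [norm_mul, Real.norm_of_nonneg (sub_nonneg.2 (logisticProb_le_one β x))]
    exact (mul_le_of_le_one_left (norm_nonneg _) (by linarith [logisticProb_pos β x])).trans hx
  rw [integral_add i1 i2]
  have hint' := hint
  rw [logisticLaw, integrable_add_measure] at hint'
  rw [logisticLaw, integral_add_measure hint'.1 hint'.2,
    integral_map (by fun_prop) hφ.aestronglyMeasurable,
    integral_map (by fun_prop) hφ.aestronglyMeasurable,
    integral_withDensity_eq_integral_toReal_smul (by fun_prop) (by simp),
    integral_withDensity_eq_integral_toReal_smul (by fun_prop) (by simp)]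
  congr 1
  · refine integral_congr_ae (ae_of_all _ fun x => ?_)
    simp [ENNReal.toReal_ofReal (logisticProb_pos β x).le]
  · refine integral_congr_ae (ae_of_all _ fun x => ?_)
    simp [ENNReal.toReal_ofReal (sub_nonneg.2 (logisticProb_le_one β x))]

theorem ae_logisticLaw_bounded {p : ℕ} {ν : Measure (Feature p)} {β : Feature p} {M : ℝ}
    (hM : ∀ᵐ x ∂ν, ‖x‖ ≤ M) : ∀ᵐ q ∂logisticLaw ν β, ‖q.1‖ ≤ M ∧ |q.2| = 1 := by
  refine ae_logisticLaw ?_ (hM.mono fun x hx => ⟨hx, by simp⟩) (hM.mono fun x hx => ⟨hx, by simp⟩)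
  exact (measurableSet_le (f := fun q : Sample p => ‖q.1‖) (by fun_prop) measurable_const).inter
    (measurableSet_eq_fun (f := fun q : Sample p => |q.2|) (by fun_prop) measurable_const)

/-! ### The excess logistic risk -/

/-- The expected excess logistic loss of `b` over `c` for features `ν` and coefficient `β`. -/
noncomputable def excessRisk {p : ℕ} (ν : Measure (Feature p)) (β c b : Feature p) : ℝ :=
  ∫ q, (linLoss b q - linLoss c q) ∂logisticLaw ν β

theorem excessRisk_eq {p : ℕ} {ν : Measure (Feature p)} [IsProbabilityMeasure ν] {M : ℝ}
    (hM : ∀ᵐ x ∂ν, ‖x‖ ≤ M) (β c b : Feature p) :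
    excessRisk ν β c b = ∫ x, (logisticProb β x * (linLoss b (x, 1) - linLoss c (x, 1)) +
      (1 - logisticProb β x) * (linLoss b (x, -1) - linLoss c (x, -1))) ∂ν :=
  integral_logisticLaw ν β (φ := fun q => linLoss b q - linLoss c q)
    ((measurable_linLoss b).sub (measurable_linLoss c)) (C := p * M * ‖b - c‖)
    (hM.mono fun x hx => abs_linLoss_sub_le (q := (x, 1)) hx (by simp) b c)
    (hM.mono fun x hx => abs_linLoss_sub_le (q := (x, -1)) hx (by simp) b c)

theorem integrable_linLoss_sub {p : ℕ} {ν : Measure (Feature p)} [IsProbabilityMeasure ν] {M : ℝ}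
    (hM : ∀ᵐ x ∂ν, ‖x‖ ≤ M) (β c b : Feature p) :
    Integrable (fun q => linLoss b q - linLoss c q) (logisticLaw ν β) :=
  Integrable.of_bound ((measurable_linLoss b).sub (measurable_linLoss c)).aestronglyMeasurable
    (p * M * ‖b - c‖)
    ((ae_logisticLaw_bounded hM).mono fun _ hq => abs_linLoss_sub_le hq.1 hq.2 b c)

theorem integrable_condExcess {p : ℕ} {ν : Measure (Feature p)} [IsProbabilityMeasure ν] {M : ℝ}
    (hM : ∀ᵐ x ∂ν, ‖x‖ ≤ M) (β c b : Feature p) :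
    Integrable (fun x => logisticProb β x * (linLoss b (x, 1) - linLoss c (x, 1)) +
      (1 - logisticProb β x) * (linLoss b (x, -1) - linLoss c (x, -1))) ν := by
  have hl : ∀ (b : Feature p) (z : ℝ), Measurable fun x : Feature p => linLoss b (x, z) :=
    fun b z => (measurable_linLoss b).comp (by fun_prop)
  have hη := measurable_logisticProb_right β
  refine Integrable.of_bound (C := p * M * ‖b - c‖) ?_ ?_
  · exact ((hη.mul ((hl b 1).sub (hl c 1))).add
      ((measurable_const.sub hη).mul ((hl b (-1)).sub (hl c (-1))))).aestronglyMeasurable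
  · filter_upwards [hM] with x hx
    have a1 := abs_le.1 (abs_linLoss_sub_le (q := (x, 1)) hx (by simp) b c)
    have a2 := abs_le.1 (abs_linLoss_sub_le (q := (x, -1)) hx (by simp) b c)
    have e1 := logisticProb_pos β x
    have e2 := sub_nonneg.2 (logisticProb_le_one β x)
    rw [Real.norm_eq_abs, abs_le]
    constructor <;> nlinarith

theorem volume_hyperplane_eq_zero {p : ℕ} {b : Feature p} (hb : b ≠ 0) :
    (volume : Measure (Feature p)) {x | x ⬝ᵥ b = 0} = 0 := by
  let f : Feature p →ₗ[ℝ] ℝ :=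
    { toFun := fun x => x ⬝ᵥ b
      map_add' := fun x y => add_dotProduct x y b
      map_smul' := fun a x => smul_dotProduct a x b }
  refine Measure.addHaar_submodule volume (LinearMap.ker f) fun h => hb ?_
  have : b ∈ LinearMap.ker f := h ▸ Submodule.mem_top
  exact dotProduct_self_eq_zero.1 this

theorem ae_dotProduct_ne_zero {p : ℕ} {ν : Measure (Feature p)} (hν : ν ≪ volume) {b : Feature p}
    (hb : b ≠ 0) : ∀ᵐ x ∂ν, x ⬝ᵥ b ≠ 0 := by
  rw [ae_iff]
  simpa using hν (volume_hyperplane_eq_zero hb)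

/-- Identifiability: off the null hyperplane orthogonal to `b - c` the two scores differ, so the
conditional excess risk is strictly positive almost everywhere. -/
theorem excessRisk_pos {p : ℕ} {ν : Measure (Feature p)} [IsProbabilityMeasure ν] {M : ℝ}
    (hM : ∀ᵐ x ∂ν, ‖x‖ ≤ M) (hν : ν ≪ volume) {c b : Feature p} (hbc : b ≠ c) :
    0 < excessRisk ν c c b := by
  have hpos : ∀ᵐ x ∂ν, 0 < logisticProb c x * (linLoss b (x, 1) - linLoss c (x, 1)) +
      (1 - logisticProb c x) * (linLoss b (x, -1) - linLoss c (x, -1)) := by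
    filter_upwards [ae_dotProduct_ne_zero hν (sub_ne_zero.2 hbc)] with x hx
    rw [dotProduct_sub] at hx
    have := condLogisticRisk_lt (s := x ⬝ᵥ c) (t := x ⬝ᵥ b) (sub_ne_zero.1 hx).symm
    simp only [linLoss, one_mul, neg_mul, logisticProb]
    linarith
  rw [excessRisk_eq hM, integral_pos_iff_support_of_nonneg_ae (hpos.mono fun x hx => hx.le)
    (integrable_condExcess hM c c b)]
  refine (measure_univ (μ := ν) ▸ one_pos : 0 < ν Set.univ).trans_le (le_of_eq ?_)
  refine (measure_congr ?_).symm
  filter_upwards [hpos] with x hx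
  exact propext ⟨fun _ => trivial, fun _ => hx.ne'⟩

theorem abs_excessRisk_sub_le {p : ℕ} {ν : Measure (Feature p)} [IsProbabilityMeasure ν] {M : ℝ}
    (hM : ∀ᵐ x ∂ν, ‖x‖ ≤ M) (β c b b' : Feature p) :
    |excessRisk ν β c b - excessRisk ν β c b'| ≤ p * M * ‖b - b'‖ := by
  unfold excessRisk
  rw [← integral_sub (integrable_linLoss_sub hM β c b) (integrable_linLoss_sub hM β c b')]
  have := norm_integral_le_of_norm_le_const (μ := logisticLaw ν β) (C := p * M * ‖b - b'‖)
    (f := fun q => linLoss b q - linLoss c q - (linLoss b' q - linLoss c q))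
    ((ae_logisticLaw_bounded hM).mono fun q hq => by
      rw [sub_sub_sub_cancel_right]
      exact abs_linLoss_sub_le hq.1 hq.2 b b')
  simpa using this

/-- The generating coefficient enters only through the label probabilities, so the integrands differ
by the change in probability times the difference of two bounded loss gaps. This gives uniformity in
`β` when the synthetic data come from a fitted coefficient. -/
theorem abs_excessRisk_sub_coef_le {p : ℕ} {ν : Measure (Feature p)} [IsProbabilityMeasure ν]
    {M : ℝ} (hM : ∀ᵐ x ∂ν, ‖x‖ ≤ M) (β β' c b : Feature p) :
    |excessRisk ν β c b - excessRisk ν β' c b| ≤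
      (p * M * ‖β - β'‖) * (2 * (p * M * ‖b - c‖)) := by
  rw [excessRisk_eq hM, excessRisk_eq hM,
    ← integral_sub (integrable_condExcess hM β c b) (integrable_condExcess hM β' c b)]
  have := norm_integral_le_of_norm_le_const (μ := ν)
    (C := (p * M * ‖β - β'‖) * (2 * (p * M * ‖b - c‖)))
    (f := fun x => logisticProb β x * (linLoss b (x, 1) - linLoss c (x, 1)) +
      (1 - logisticProb β x) * (linLoss b (x, -1) - linLoss c (x, -1)) -
      (logisticProb β' x * (linLoss b (x, 1) - linLoss c (x, 1)) +
      (1 - logisticProb β' x) * (linLoss b (x, -1) - linLoss c (x, -1))))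
    (by
      filter_upwards [hM] with x hx
      have a1 := abs_linLoss_sub_le (q := (x, 1)) hx (by simp) b c
      have a2 := abs_linLoss_sub_le (q := (x, -1)) hx (by simp) b c
      have a3 := abs_logisticProb_sub_le hx β β'
      have e : logisticProb β x * (linLoss b (x, 1) - linLoss c (x, 1)) +
          (1 - logisticProb β x) * (linLoss b (x, -1) - linLoss c (x, -1)) -
          (logisticProb β' x * (linLoss b (x, 1) - linLoss c (x, 1)) +
          (1 - logisticProb β' x) * (linLoss b (x, -1) - linLoss c (x, -1))) =
          (logisticProb β x - logisticProb β' x) * ((linLoss b (x, 1) - linLoss c (x, 1)) -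
            (linLoss b (x, -1) - linLoss c (x, -1))) := by ring
      rw [e, norm_mul]
      refine mul_le_mul a3 ((norm_sub_le _ _).trans ?_) (norm_nonneg _)
        ((abs_nonneg _).trans a3)
      rw [Real.norm_eq_abs, Real.norm_eq_abs]
      linarith)
  simpa using this

/-! ### A law of large numbers -/

/-- Chebyshev's inequality for the mean of `n` independent copies of a bounded variable. -/
theorem pi_abs_mean_sub_integral_ge_le {α : Type*} [MeasurableSpace α] (Q : Measure α)
    [IsProbabilityMeasure Q] {φ : α → ℝ} (hφ : Measurable φ) {C : ℝ} (hC : ∀ᵐ q ∂Q, |φ q| ≤ C)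
    {n : ℕ} (hn : 0 < n) {ε : ℝ} (hε : 0 < ε) :
    Measure.pi (fun _ : Fin n => Q) {D | ε ≤ |(1 / (n : ℝ)) * ∑ i, φ (D i) - ∫ q, φ q ∂Q|} ≤
      ENNReal.ofReal (C ^ 2 / ε ^ 2 / n) := by
  set P := Measure.pi fun _ : Fin n => Q
  have hn' : (0 : ℝ) < n := Nat.cast_pos.2 hn
  have hmem : MemLp φ 2 Q := MemLp.of_bound hφ.aestronglyMeasurable C hC
  have hmp : ∀ i, MeasurePreserving (fun D : Fin n → α => D i) P Q :=
    fun i => measurePreserving_eval (fun _ => Q) i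
  have hLp : ∀ i ∈ Finset.univ, MemLp (fun D : Fin n → α => φ (D i)) 2 P :=
    fun i _ => hmem.comp_measurePreserving (hmp i)
  have hind : iIndepFun (fun (i : Fin n) (D : Fin n → α) => φ (D i)) P :=
    iIndepFun_pi (X := fun _ => φ) fun _ => hφ.aemeasurable
  have hvar : variance (∑ i, fun D : Fin n → α => φ (D i)) P ≤ n * C ^ 2 := by
    rw [IndepFun.variance_sum hLp fun i _ j _ hij => hind.indepFun hij]
    have : ∀ i, variance (fun D : Fin n → α => φ (D i)) P ≤ C ^ 2 := fun i => by
      have h := variance_le_sq_of_bounded (μ := P) (a := -C) (b := C)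
        (X := fun D : Fin n → α => φ (D i))
        ((hmp i).quasiMeasurePreserving.ae (hC.mono fun q hq => abs_le.1 hq))
        (hφ.comp (hmp i).measurable).aemeasurable
      refine h.trans (le_of_eq ?_)
      ring
    refine (Finset.sum_le_sum fun i _ => this i).trans ?_
    simp
  have hmean : ∫ D, (∑ i, fun D : Fin n → α => φ (D i)) D ∂P = n * ∫ q, φ q ∂Q := by
    simp only [Finset.sum_apply]
    rw [integral_finsetSum _ fun i hi => (hLp i hi).integrable (by norm_num)]
    have : ∀ i, ∫ D, φ (D i) ∂P = ∫ q, φ q ∂Q := fun i => by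
      rw [← (hmp i).map_eq, integral_map (hmp i).measurable.aemeasurable
        hφ.aestronglyMeasurable]
    simp [this]
  have key := meas_ge_le_variance_div_sq (memLp_finsetSum' _ hLp) (mul_pos hn' hε)
  rw [hmean] at key
  refine (measure_mono fun D hD => ?_).trans (key.trans (ENNReal.ofReal_le_ofReal ?_))
  · simp only [Set.mem_ofPred_eq, Finset.sum_apply] at hD ⊢
    have e : ∑ i, φ (D i) - n * ∫ q, φ q ∂Q =
        n * ((1 / (n : ℝ)) * ∑ i, φ (D i) - ∫ q, φ q ∂Q) := by field_simp
    rw [e, abs_mul, abs_of_pos hn']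
    gcongr
  · calc _ ≤ n * C ^ 2 / (n * ε) ^ 2 := by gcongr
      _ = C ^ 2 / ε ^ 2 / n := by field_simp

/-! ### Localization of the empirical minimizers -/

theorem exists_forall_sphere_le_excessRisk {p : ℕ} {ν : Measure (Feature p)}
    [IsProbabilityMeasure ν] {M : ℝ} (hM : ∀ᵐ x ∂ν, ‖x‖ ≤ M) (hν : ν ≪ volume) (c : Feature p)
    {r : ℝ} (hr : 0 < r) :
    ∃ ε > 0, ∀ u ∈ Metric.sphere c r, ε ≤ excessRisk ν c c u := by
  -- The sphere is empty only for `p = 0`.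
  rcases (Metric.sphere c r).eq_empty_or_nonempty with h | h
  · exact ⟨1, one_pos, by simp [h]⟩
  have hcont : Continuous fun u => excessRisk ν c c u := by
    have hM0 : 0 ≤ M := by
      obtain ⟨x, hx⟩ := hM.exists
      exact (norm_nonneg x).trans hx
    refine (LipschitzWith.of_dist_le_mul (K := ⟨p * M, by positivity⟩) fun u v => ?_).continuous
    rw [Real.dist_eq, dist_eq_norm]
    exact abs_excessRisk_sub_le hM c c u v
  obtain ⟨u, hu, hmin⟩ := (isCompact_sphere c r).exists_isMinOn h hcont.continuousOn
  refine ⟨_, excessRisk_pos hM hν (fun huc => ?_), fun v hv => hmin hv⟩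
  rw [huc, mem_sphere_iff_norm, sub_self, norm_zero] at hu
  exact hr.ne hu

theorem ae_iidLaw_forall {p : ℕ} {Q : Measure (Sample p)} [IsProbabilityMeasure Q]
    {P : Sample p → Prop} (h : ∀ᵐ q ∂Q, P q) (m : ℕ) : ∀ᵐ D ∂iidLaw Q m, ∀ i, P (D i) :=
  ae_all_iff.2 fun i =>
    (measurePreserving_eval (fun _ : Fin m => Q) i).quasiMeasurePreserving.ae h

theorem abs_empLogisticRisk_sub_le {p m : ℕ} {M : ℝ} {D : Dataset p m}
    (hD : ∀ i, ‖(D i).1‖ ≤ M ∧ |(D i).2| = 1) (hm : 0 < m) (b b' : Feature p) :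
    |empLogisticRisk D (linearScore b) - empLogisticRisk D (linearScore b')| ≤
      p * M * ‖b - b'‖ := by
  have hm' : (0 : ℝ) < m := Nat.cast_pos.2 hm
  rw [empLogisticRisk_linearScore, empLogisticRisk_linearScore, ← mul_sub,
    ← Finset.sum_sub_distrib, abs_mul, abs_of_pos (by positivity), one_div, inv_mul_le_iff₀ hm']
  refine (Finset.abs_sum_le_sum_abs _ _).trans ((Finset.sum_le_sum fun i _ =>
    abs_linLoss_sub_le (hD i).1 (hD i).2 b b').trans ?_)
  simp

/-- Around a coefficient `c` and uniformly over the coefficients `β` near `c` that generate the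
data, the empirical logistic risk exceeds on a sphere its value at the centre `c`, off an event of
probability `O(1/m)`. -/
theorem exists_localization {p : ℕ} {ν : Measure (Feature p)} [IsProbabilityMeasure ν] {M : ℝ}
    (hM : ∀ᵐ x ∂ν, ‖x‖ ≤ M) (hν : ν ≪ volume) (c : Feature p) {r : ℝ} (hr : 0 < r) :
    ∃ η > 0, ∃ K : ℝ, ∃ A : ∀ m, Set (Dataset p m), (∀ m, MeasurableSet (A m)) ∧
      (∀ m, 0 < m → ∀ β, ‖β - c‖ ≤ η →
        iidLaw (logisticLaw ν β) m (A m) ≤ ENNReal.ofReal (K / m)) ∧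
      ∀ m, 0 < m → ∀ D ∉ A m, ∀ u, ‖u - c‖ = r →
        empLogisticRisk D (linearScore c) < empLogisticRisk D (linearScore u) := by
  have hM0 : 0 ≤ M := by
    obtain ⟨x, hx⟩ := hM.exists
    exact (norm_nonneg x).trans hx
  set κ : ℝ := p * M with hκ
  have hκ0 : 0 ≤ κ := by positivity
  obtain ⟨ε', hε', hgap⟩ := exists_forall_sphere_le_excessRisk hM hν c hr
  -- One `ε` pays for the deviation at net points, one for the distance to the net, and one remains
  -- as the strict gap.
  obtain ⟨ε, hε, rfl⟩ : ∃ ε > 0, ε' = 3 * ε := ⟨ε' / 3, by positivity, by ring⟩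
  obtain ⟨T₀, hTs, hTf, hTc⟩ := (isCompact_sphere c r).finite_cover_balls
    (show 0 < ε / (κ + 1) by positivity)
  lift T₀ to Finset (Feature p) using hTf with T
  -- Deviations are measured from the risk under `c`, not under `β`, so that the exceptional event
  -- does not depend on `β`.
  let dev : ∀ m, Feature p → Set (Dataset p m) := fun m b =>
    {D | ε ≤ |(1 / (m : ℝ)) * ∑ i, (linLoss b (D i) - linLoss c (D i)) - excessRisk ν c c b|}
  have hdev : ∀ m b, MeasurableSet (dev m b) := by
    intro m b
    have h1 := measurable_linLoss b
    have h2 := measurable_linLoss c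
    refine measurableSet_le measurable_const (Measurable.abs (Measurable.sub_const
      (Measurable.const_mul (Finset.measurable_fun_sum _ fun i _ => ?_) _) _))
    exact (h1.comp (measurable_pi_apply i)).sub (h2.comp (measurable_pi_apply i))
  have hgood : ∀ m, MeasurableSet {D : Dataset p m | ∀ i, ‖(D i).1‖ ≤ M ∧ |(D i).2| = 1} := by
    intro m
    rw [Set.ofPred_forall]
    refine MeasurableSet.iInter fun i => (measurableSet_le (f := fun D : Dataset p m => ‖(D i).1‖)
      (by fun_prop) measurable_const).inter (measurableSet_eq_fun
        (f := fun D : Dataset p m => |(D i).2|) (by fun_prop) measurable_const)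
  -- The radius keeps the shift of the risk from `β` to `c` below `ε / 2`, leaving `ε / 2` for
  -- Chebyshev; the `+ 1` avoids a zero denominator. The constant is the net size times the
  -- Chebyshev bound for a variable bounded by `κ * r`. The null set of irregular samples joins the
  -- event so that the Lipschitz bound holds surely outside it.
  refine ⟨ε / 2 / (2 * κ * (κ * r) + 1), by positivity,
    T.card * ((κ * r) ^ 2 / (ε / 2) ^ 2),
    fun m => {D | ∀ i, ‖(D i).1‖ ≤ M ∧ |(D i).2| = 1}ᶜ ∪ ⋃ b ∈ T, dev m b, fun m => ?_,
    fun m hm β hβ => ?_, fun m hm D hD u hu => ?_⟩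
  · exact (hgood m).compl.union (T.measurableSet_biUnion fun b _ => hdev m b)
  · have hbad : iidLaw (logisticLaw ν β) m {D | ∀ i, ‖(D i).1‖ ≤ M ∧ |(D i).2| = 1}ᶜ = 0 :=
      ae_iidLaw_forall (ae_logisticLaw_bounded hM) m
    have hone : ∀ b ∈ T, iidLaw (logisticLaw ν β) m (dev m b) ≤
        ENNReal.ofReal ((κ * r) ^ 2 / (ε / 2) ^ 2 / m) := by
      intro b hb
      have hbr : ‖b - c‖ = r := mem_sphere_iff_norm.1 (hTs hb)
      have hcoef : |excessRisk ν β c b - excessRisk ν c c b| ≤ ε / 2 := by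
        refine (abs_excessRisk_sub_coef_le hM β c c b).trans ?_
        rw [hbr, ← hκ]
        have h1 : κ * ‖β - c‖ * (2 * (κ * r)) ≤
            κ * (ε / 2 / (2 * κ * (κ * r) + 1)) * (2 * (κ * r)) := by gcongr
        refine h1.trans ?_
        rw [show κ * (ε / 2 / (2 * κ * (κ * r) + 1)) * (2 * (κ * r)) =
          ε / 2 * ((2 * κ * (κ * r)) / (2 * κ * (κ * r) + 1)) by ring]
        refine mul_le_of_le_one_right (by positivity) ((div_le_one (by positivity)).2 ?_)
        linarith
      refine (measure_mono fun D hD => ?_).trans (pi_abs_mean_sub_integral_ge_le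
        (logisticLaw ν β) (φ := fun q => linLoss b q - linLoss c q)
        ((measurable_linLoss b).sub (measurable_linLoss c)) (C := κ * r)
        ((ae_logisticLaw_bounded hM).mono fun q hq =>
          hbr ▸ abs_linLoss_sub_le hq.1 hq.2 b c) hm (half_pos hε))
      change ε ≤ _ at hD
      change ε / 2 ≤ |_ - excessRisk ν β c b|
      have h3 := abs_sub_le
        ((1 / (m : ℝ)) * ∑ i, (linLoss b (D i) - linLoss c (D i))) (excessRisk ν β c b)
        (excessRisk ν c c b)
      linarith
    calc _ ≤ 0 + ∑ b ∈ T, iidLaw (logisticLaw ν β) m (dev m b) :=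
          (measure_union_le _ _).trans (add_le_add hbad.le (measure_biUnion_finset_le _ _))
      _ ≤ ∑ b ∈ T, ENNReal.ofReal ((κ * r) ^ 2 / (ε / 2) ^ 2 / m) := by
          rw [zero_add]; exact Finset.sum_le_sum hone
      _ = _ := by
          rw [Finset.sum_const, nsmul_eq_mul, mul_div_assoc, ENNReal.ofReal_mul (by positivity),
            ENNReal.ofReal_natCast]
  · simp only [Set.mem_union, not_or, Set.notMem_compl_iff, Set.mem_iUnion, not_exists] at hD
    obtain ⟨hDg, hDT⟩ := hD
    obtain ⟨b, hb, hub⟩ : ∃ b ∈ T, ‖u - b‖ < ε / (κ + 1) := by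
      have := hTc (mem_sphere_iff_norm.2 hu)
      simp only [Set.mem_iUnion, mem_ball_iff_norm] at this
      obtain ⟨b, hb, h⟩ := this
      exact ⟨b, hb, h⟩
    have h1 := hDT b hb
    simp only [dev, Set.mem_ofPred_eq, not_le] at h1
    have h2 := hgap b (hTs hb)
    have h3 := (abs_le.1 (abs_empLogisticRisk_sub_le hDg hm u b)).1
    have h4 : κ * ‖u - b‖ ≤ ε := by
      have : (κ + 1) * ‖u - b‖ ≤ ε := by
        rw [mul_comm]; exact ((lt_div_iff₀ (by positivity)).1 hub).le
      linarith [norm_nonneg (u - b)]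
    have h5 : (1 / (m : ℝ)) * ∑ i, (linLoss b (D i) - linLoss c (D i)) =
        empLogisticRisk D (linearScore b) - empLogisticRisk D (linearScore c) := by
      rw [Finset.sum_sub_distrib, mul_sub]; rfl
    rw [h5] at h1
    have h6 := (abs_lt.1 h1).1
    linarith

/-! ### The 0-1 risk of a linear classifier -/

theorem measurable_sign : Measurable Real.sign := by
  unfold Real.sign
  exact Measurable.ite measurableSet_Iio measurable_const
    (Measurable.ite measurableSet_Ioi measurable_const measurable_const)

theorem measurableSet_misclassified {p : ℕ} (b : Feature p) :
    MeasurableSet {q : Sample p | Real.sign (linearScore b q.1) ≠ q.2} := by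
  have h : Measurable fun q : Sample p => Real.sign (linearScore b q.1) := by
    unfold linearScore dotProduct
    exact measurable_sign.comp (by fun_prop)
  exact (measurableSet_eq_fun h measurable_snd).compl

theorem eventually_sign_eq {s : ℝ} (hs : s ≠ 0) : ∀ᶠ t in 𝓝 s, Real.sign t = Real.sign s := by
  rcases hs.lt_or_gt with h | h
  · filter_upwards [Iio_mem_nhds h] with t ht
    rw [Real.sign_of_neg h, Real.sign_of_neg ht]
  · filter_upwards [Ioi_mem_nhds h] with t ht
    rw [Real.sign_of_pos h, Real.sign_of_pos ht]

/-- Off the null hyperplane orthogonal to `b`, the sign of the score is locally constant in the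
coefficient, so the error indicators converge almost everywhere. -/
theorem tendsto_zeroOneRisk {p : ℕ} {ν : Measure (Feature p)} [IsProbabilityMeasure ν]
    (hν : ν ≪ volume) (β : Feature p) {b : Feature p} (hb : b ≠ 0) :
    Tendsto (fun u => zeroOneRisk (logisticLaw ν β) (linearScore u)) (𝓝 b)
      (𝓝 (zeroOneRisk (logisticLaw ν β) (linearScore b))) := by
  refine (ENNReal.tendsto_toReal (measure_ne_top _ _)).comp
    (tendsto_measure_of_ae_tendsto_indicator _ (measurableSet_misclassified b)
      measurableSet_misclassified MeasurableSet.univ (measure_ne_top _ _)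
      (Eventually.of_forall fun _ => Set.subset_univ _) ?_)
  have hne : ∀ᵐ q ∂logisticLaw ν β, q.1 ⬝ᵥ b ≠ 0 := by
    have h := ae_dotProduct_ne_zero hν hb
    refine ae_logisticLaw ?_ h h
    refine (measurableSet_eq_fun (f := fun q : Sample p => q.1 ⬝ᵥ b) ?_ measurable_const).compl
    unfold dotProduct
    fun_prop
  filter_upwards [hne] with q hq
  have hc : Continuous fun u : Feature p => q.1 ⬝ᵥ u := by unfold dotProduct; fun_prop
  filter_upwards [hc.continuousAt.eventually (eventually_sign_eq hq)] with u hu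
  simp only [linearScore, hu]

/-- If the labels are fair coins, every nonzero linear classifier has 0-1 risk `1/2`. -/
theorem zeroOneRisk_zero_coef {p : ℕ} {ν : Measure (Feature p)} [IsProbabilityMeasure ν]
    (hν : ν ≪ volume) {b : Feature p} (hb : b ≠ 0) :
    zeroOneRisk (logisticLaw ν 0) (linearScore b) = 1 / 2 := by
  have hη : ∀ x : Feature p, logisticProb 0 x = 2⁻¹ := fun x => by
    simp [logisticProb]; norm_num
  have h2 : ENNReal.ofReal (2⁻¹ : ℝ) = 2⁻¹ := by
    rw [ENNReal.ofReal_inv_of_pos two_pos]; simp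
  have h2' : ENNReal.ofReal (1 - 2⁻¹ : ℝ) = 2⁻¹ := by
    rw [← h2]; norm_num
  have key : logisticLaw ν 0 {q : Sample p | Real.sign (linearScore b q.1) ≠ q.2} = 2⁻¹ := by
    rw [logisticLaw_apply ν 0 (measurableSet_misclassified b), ← lintegral_add_left]
    · have : ∀ᵐ x ∂ν, ((fun x => (x, (1 : ℝ))) ⁻¹'
          {q : Sample p | Real.sign (linearScore b q.1) ≠ q.2}).indicator
            (fun x => ENNReal.ofReal (logisticProb 0 x)) x +
          ((fun x => (x, (-1 : ℝ))) ⁻¹'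
          {q : Sample p | Real.sign (linearScore b q.1) ≠ q.2}).indicator
            (fun x => ENNReal.ofReal (1 - logisticProb 0 x)) x = 2⁻¹ := by
        filter_upwards [ae_dotProduct_ne_zero hν hb] with x hx
        simp only [Set.indicator, Set.mem_preimage, Set.mem_ofPred_eq, linearScore, hη, h2, h2']
        rcases hx.lt_or_gt with h | h
        · rw [Real.sign_of_neg h]; norm_num
        · rw [Real.sign_of_pos h]; norm_num
      rw [lintegral_congr_ae this]
      simp
    · exact (measurable_logisticProb_right 0).ennreal_ofReal.indicator
        ((show Measurable fun x : Feature p => (x, (1 : ℝ)) by fun_prop)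
          (measurableSet_misclassified b))
  rw [zeroOneRisk, measureReal_def, key]
  simp

/-! ### The zero classifier is almost surely not an empirical minimizer -/

/-- First-order condition at `0`, which is interior to the box: the loss has slope `-1/2` there, so
the `k`-th partial derivative is a nonzero multiple of this sum. -/
theorem sum_eq_zero_of_isLogisticERM_zero {p n : ℕ} {B : ℝ} (hB : 0 < B) (hn : 0 < n)
    {D : Dataset p n}
    (h : IsLogisticERM (boundedLinearClass p B) D (linearScore 0)) (k : Fin p) :
    ∑ i, (D i).2 * (D i).1 k = 0 := by
  let F : ℝ → ℝ := fun t => (1 / (n : ℝ)) * ∑ i, logLoss (t * ((D i).2 * (D i).1 k))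
  have hF : ∀ t, F t = empLogisticRisk D (linearScore (Pi.single k t)) := fun t => by
    rw [empLogisticRisk_linearScore]
    simp only [F, linLoss, dotProduct_single]
    congr 1
    exact Finset.sum_congr rfl fun i _ => by congr 1; ring
  have hmin : IsLocalMin F 0 := by
    filter_upwards [Ioo_mem_nhds (neg_neg_of_pos hB) hB] with t ht
    rw [hF, hF, Pi.single_zero]
    refine h.2 _ ⟨Pi.single k t, fun i => ?_, rfl⟩
    rcases eq_or_ne i k with rfl | hik
    · simpa using ⟨ht.1.le, ht.2.le⟩
    · simpa [hik] using hB.le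
  have hder : HasDerivAt F ((1 / (n : ℝ)) * ∑ i, -(1 / 2) * ((D i).2 * (D i).1 k)) 0 := by
    refine (HasDerivAt.fun_sum fun i _ => ?_).const_mul _
    have h1 := (hasDerivAt_logLoss (0 * ((D i).2 * (D i).1 k))).comp (0 : ℝ)
      ((hasDerivAt_id (0 : ℝ)).mul_const ((D i).2 * (D i).1 k))
    refine h1.congr_deriv ?_
    norm_num
  have h0 := hmin.hasDerivAt_eq_zero hder
  rw [← Finset.mul_sum] at h0
  have hn' : (n : ℝ) ≠ 0 := Nat.cast_ne_zero.2 hn.ne'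
  simpa [hn'] using h0

/-- With the other samples fixed, the first one must have `z * x k` equal to a prescribed number; as
`z = ±1`, this puts `x` in one of two null hyperplanes. -/
theorem iidLaw_sum_eq_zero {p : ℕ} {ν : Measure (Feature p)} [IsProbabilityMeasure ν]
    (hν : ν ≪ volume) (β : Feature p) (k : Fin p) {n : ℕ} (hn : 0 < n) :
    iidLaw (logisticLaw ν β) n {D | ∑ i, (D i).2 * (D i).1 k = 0} = 0 := by
  obtain ⟨n, rfl⟩ := Nat.exists_eq_succ_of_ne_zero hn.ne'
  set Q := logisticLaw ν β
  have hatom : ∀ a : ℝ, ∀ᵐ q ∂Q, q.2 * q.1 k + a ≠ 0 := by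
    intro a
    have hx : ∀ a : ℝ, ∀ᵐ x ∂ν, x k ≠ a := fun a => by
      rw [ae_iff]
      simpa using hν (Measure.pi_hyperplane (fun _ : Fin p => (volume : Measure ℝ)) k a)
    refine ae_logisticLaw ?_ ((hx (-a)).mono fun x h h' => h ?_) ((hx a).mono fun x h h' => h ?_)
    · exact (measurableSet_eq_fun (f := fun q : Sample p => q.2 * q.1 k + a) (by fun_prop)
        measurable_const).compl
    · simp only [one_mul] at h'; linarith
    · simp only [neg_mul, one_mul] at h'; linarith
  have hmp := measurePreserving_piFinSuccAbove (fun _ : Fin (n + 1) => Q) 0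
  let S : Set (Sample p × Dataset p n) :=
    {y | y.1.2 * y.1.1 k + ∑ i, (y.2 i).2 * (y.2 i).1 k = 0}
  have hS : MeasurableSet S := measurableSet_eq_fun (by fun_prop) measurable_const
  have hpre : {D : Dataset p (n + 1) | ∑ i, (D i).2 * (D i).1 k = 0} =
      MeasurableEquiv.piFinSuccAbove (fun _ => Sample p) 0 ⁻¹' S := by
    ext D
    simp [S, Fin.sum_univ_succ, Fin.tail]
  rw [Nat.succ_eq_add_one, iidLaw, hpre, hmp.measure_preimage hS.nullMeasurableSet,
    Measure.prod_apply_symm hS]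
  exact lintegral_eq_zero_of_ae_eq_zero (ae_of_all _ fun y => by
    simpa [S, ae_iff] using hatom (∑ i, (y i).2 * (y i).1 k))

/-! ### Consistency of the synthetic classifier -/

theorem HasDensityOn.absolutelyContinuous {p : ℕ} {μ : Measure (Feature p)} {𝒳 : Set (Feature p)}
    {f : Feature p → ℝ} (h : HasDensityOn μ 𝒳 f) : μ ≪ volume :=
  h.eq_withDensity ▸ withDensity_absolutelyContinuous _ _

theorem HasDensityOn.ae_mem {p : ℕ} {μ : Measure (Feature p)} {𝒳 : Set (Feature p)}
    {f : Feature p → ℝ} (h : HasDensityOn μ 𝒳 f) : ∀ᵐ x ∂μ, x ∈ 𝒳 := by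
  rw [h.eq_withDensity, ae_withDensity_iff h.measurable.ennreal_ofReal]
  refine ae_of_all _ fun x hx => ?_
  by_contra hx'
  exact hx (by rw [h.eq_zero_of_notMem x hx', ENNReal.ofReal_zero])

/-- An event that forces the original data into `A` or the synthetic data into `A'` has small
probability if `A` does and if `A'` does for every original data set outside `A`. -/
theorem jointLaw_le_add {p : ℕ} (μ ν : Measure (Feature p)) [IsProbabilityMeasure μ]
    [IsProbabilityMeasure ν] (βstar : Feature p) {n m : ℕ} (βhat : Dataset p n → Feature p)
    (hβ : Measurable βhat) {A : Set (Dataset p n)} {A' : Set (Dataset p m)}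
    (hA : MeasurableSet A) (hA' : MeasurableSet A') {s : Set (Dataset p n × Dataset p m)}
    {a a' : ℝ≥0∞} (ha : iidLaw (logisticLaw μ βstar) n A ≤ a)
    (ha' : ∀ D ∉ A, iidLaw (logisticLaw ν (βhat D)) m A' ≤ a')
    (hs : ∀ ω ∈ s, ω.1 ∈ A ∨ ω.2 ∈ A') :
    jointLaw μ ν βstar n m βhat hβ s ≤ a + a' := by
  have hsub : s ⊆ A ×ˢ Set.univ ∪ Aᶜ ×ˢ A' := by
    intro ω hω
    by_cases h : ω.1 ∈ A
    · exact Or.inl ⟨h, trivial⟩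
    · exact Or.inr ⟨h, (hs ω hω).resolve_left h⟩
  refine (measure_mono hsub).trans ((measure_union_le _ _).trans (add_le_add ?_ ?_))
  · rw [jointLaw, Measure.compProd_apply_prod hA MeasurableSet.univ]
    simpa using ha
  · rw [jointLaw, Measure.compProd_apply_prod hA.compl hA']
    refine (setLIntegral_mono (s := Aᶜ) (g := fun _ => a') measurable_const
      fun D hD => ha' D hD).trans ?_
    rw [setLIntegral_const]
    exact mul_le_of_le_one_right' prob_le_one

/-- The inner limit removes `K' / m`, and the outer one removes `K / n`. -/
theorem tendsto_limsup_zero_of_le {f : ℕ → ℕ → ℝ≥0∞} {K K' : ℝ}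
    (h : ∀ n m, 0 < n → 0 < m → f n m ≤ ENNReal.ofReal (K / n) + ENNReal.ofReal (K' / m)) :
    Tendsto (fun n => limsup (f n) atTop) atTop (𝓝 0) := by
  have h0 : ∀ K : ℝ, Tendsto (fun n : ℕ => ENNReal.ofReal (K / n)) atTop (𝓝 0) := fun K => by
    simpa using ENNReal.tendsto_ofReal (tendsto_const_div_atTop_nhds_zero_nat K)
  refine tendsto_of_tendsto_of_tendsto_of_le_of_le' tendsto_const_nhds (h0 K)
    (Eventually.of_forall fun _ => zero_le) ?_
  filter_upwards [eventually_gt_atTop 0] with n hn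
  have hlim := (tendsto_const_nhds (x := ENNReal.ofReal (K / n))).add (h0 K')
  rw [add_zero] at hlim
  rw [← hlim.limsup_eq]
  refine limsup_le_limsup ?_
  filter_upwards [eventually_gt_atTop 0] with m hm using h n m hn hm

theorem mem_boundedLinearClass_of_norm_le {p : ℕ} {β : Feature p} {B : ℝ} (h : ‖β‖ ≤ B) :
    linearScore β ∈ boundedLinearClass p B :=
  ⟨β, fun i => abs_le.1 ((norm_le_pi_norm β i).trans h), rfl⟩

/-- A constrained empirical minimizer has a coefficient near `c` if the empirical risk exceeds on
a sphere its value at the centre `c`. -/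
theorem IsLogisticERM.exists_norm_sub_lt {p n : ℕ} {B : ℝ} {D : Dataset p n} {g : Feature p → ℝ}
    (h : IsLogisticERM (boundedLinearClass p B) D g) {c : Feature p} (hc : ‖c‖ ≤ B) {r : ℝ}
    (hr : 0 < r) (hs : ∀ u, ‖u - c‖ = r →
      empLogisticRisk D (linearScore c) < empLogisticRisk D (linearScore u)) :
    ∃ b, g = linearScore b ∧ ‖b - c‖ < r := by
  obtain ⟨b, -, rfl⟩ := h.1
  exact ⟨b, rfl, (convexOn_empLogisticRisk D).norm_sub_lt_of_lt_on_sphere hr hs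
    (h.2 _ (mem_boundedLinearClass_of_norm_le hc))⟩

theorem zeroOneRisk_zero_coef_of_isLogisticERM {p n : ℕ} {ν : Measure (Feature p)}
    [IsProbabilityMeasure ν] (hν : ν ≪ volume) {B : ℝ} (hB : 0 < B) (hn : 0 < n)
    {D : Dataset p n} {g : Feature p → ℝ} (h : IsLogisticERM (boundedLinearClass p B) D g)
    {k : Fin p} (hk : ∑ i, (D i).2 * (D i).1 k ≠ 0) :
    zeroOneRisk (logisticLaw ν 0) g = 1 / 2 := by
  obtain ⟨b, -, rfl⟩ := h.1
  refine zeroOneRisk_zero_coef hν fun hb => hk ?_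
  subst hb
  exact sum_eq_zero_of_isLogisticERM_zero hB hn h k

theorem theoremS1 (p : ℕ) (𝒳 : Set (Feature p)) (h𝒳 : IsCompact 𝒳)
    -- laws of the original and of the synthetic features, with densities on `𝒳`
    (PX PXt : Measure (Feature p)) [IsProbabilityMeasure PX] [IsProbabilityMeasure PXt]
    (fX fXt : Feature p → ℝ) (hX : HasDensityOn PX 𝒳 fX) (hXt : HasDensityOn PXt 𝒳 fXt)
    (C₁ : ℝ) (hC₁ : 0 < C₁) (hratio : ∀ x ∈ 𝒳, fXt x ≤ C₁ * fX x)
    (βstar : Feature p) (B : ℝ) (hB : ‖βstar‖ < B / 2)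
    -- the maximum likelihood estimator (arbitrary on data sets for which none exists)
    (βhat : ∀ n : ℕ, Dataset p n → Feature p) (hβmeas : ∀ n, Measurable (βhat n))
    (hβ : ∀ n D, (∃ β, IsLogisticMLE D β) → IsLogisticMLE D (βhat n D))
    -- the downstream classifiers fitted on the original and on the synthetic data
    (ghat gtilde : ∀ n : ℕ, Dataset p n → Feature p → ℝ)
    (hghat_meas : ∀ n, Measurable (ghat n)) (hgtilde_meas : ∀ n, Measurable (gtilde n))
    (hghat : ∀ n D, IsLogisticERM (boundedLinearClass p B) D (ghat n D))
    (hgtilde : ∀ n D, IsLogisticERM (boundedLinearClass p B) D (gtilde n D))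
    (δ : ℝ) (hδ : 0 < δ) :
    Tendsto
      (fun n : ℕ =>
        limsup
          (fun m : ℕ =>
            jointLaw PX PXt βstar n m (βhat n) (hβmeas n)
              {ω | δ < classUtility (logisticLaw PX βstar) (gtilde m ω.2) (ghat n ω.1)})
          atTop)
      atTop (𝓝 0) := by
  have hB0 : 0 < B := by linarith [norm_nonneg βstar]
  have hcB : ‖βstar‖ ≤ B := by linarith
  have hacX := hX.absolutelyContinuous
  have hacXt := hXt.absolutelyContinuous
  rcases eq_or_ne βstar 0 with rfl | hne
  -- For `p = 0` the class has a single element. Otherwise one coordinate `k` suffices to exclude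
  -- the zero classifier almost surely in both samples.
  · rcases isEmpty_or_nonempty (Fin p) with hp | ⟨⟨k⟩⟩
    · refine tendsto_limsup_zero_of_le (K := 0) (K' := 0) fun n m _ _ => ?_
      refine (jointLaw_le_add PX PXt 0 (βhat n) (hβmeas n) MeasurableSet.empty
        MeasurableSet.empty (a := 0) (a' := 0) (by simp) (by simp) fun ω hω => ?_).trans (by simp)
      obtain ⟨b, -, hb⟩ := (hghat n ω.1).1
      obtain ⟨b', -, hb'⟩ := (hgtilde m ω.2).1
      rw [Set.mem_ofPred_eq, hb, hb', Subsingleton.elim b b', classUtility, sub_self,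
        abs_zero] at hω
      exact absurd hω hδ.not_gt
    · have hmeas : ∀ n, MeasurableSet {D : Dataset p n | ∑ i, (D i).2 * (D i).1 k = 0} :=
        fun n => measurableSet_eq_fun (by fun_prop) measurable_const
      refine tendsto_limsup_zero_of_le (K := 0) (K' := 0) fun n m hn hm => ?_
      refine (jointLaw_le_add PX PXt 0 (βhat n) (hβmeas n) (hmeas n) (hmeas m) (a := 0) (a' := 0)
        (iidLaw_sum_eq_zero hacX 0 k hn).le
        (fun D _ => (iidLaw_sum_eq_zero hacXt (βhat n D) k hm).le) fun ω hω => ?_).trans (by simp)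
      by_contra! hcon
      rw [Set.mem_ofPred_eq, classUtility,
        zeroOneRisk_zero_coef_of_isLogisticERM hacX hB0 hn (hghat n ω.1) hcon.1,
        zeroOneRisk_zero_coef_of_isLogisticERM hacX hB0 hm (hgtilde m ω.2) hcon.2, sub_self,
        abs_zero] at hω
      exact absurd hω hδ.not_gt
  · obtain ⟨M, hM⟩ := h𝒳.isBounded.exists_norm_le
    have hMX : ∀ᵐ x ∂PX, ‖x‖ ≤ M := hX.ae_mem.mono hM
    have hMXt : ∀ᵐ x ∂PXt, ‖x‖ ≤ M := hXt.ae_mem.mono hM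
    obtain ⟨r, hr, hrisk⟩ := Metric.tendsto_nhds_nhds.1
      (tendsto_zeroOneRisk hacX βstar hne) (δ / 2) (half_pos hδ)
    -- The synthetic sample is treated before the original one because it dictates the accuracy `η`
    -- required of `βhat`. The original radius `min r η` then serves both `ghat` and `βhat`.
    obtain ⟨η, hη, K', A', hA', hA'le, hA's⟩ := exists_localization hMXt hacXt βstar hr
    obtain ⟨η₀, hη₀, K, A, hA, hAle, hAs⟩ :=
      exists_localization hMX hacX βstar (lt_min hr hη)
    refine tendsto_limsup_zero_of_le (K := K) (K' := K') fun n m hn hm => ?_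
    refine jointLaw_le_add PX PXt βstar (βhat n) (hβmeas n) (hA n) (hA' m)
      (hAle n hn βstar (by simpa using hη₀.le)) (fun D hD => hA'le m hm _ ?_) fun ω hω => ?_
    -- The sphere inequality first yields existence of a minimizer, without which `βhat n D` is
    -- arbitrary.
    · have hmle : IsLogisticMLE D (βhat n D) := hβ n D
        ((convexOn_empLogisticRisk D).exists_forall_le_of_lt_on_sphere
          (continuous_empLogisticRisk D) (lt_min hr hη) (hAs n hn D hD))
      exact ((convexOn_empLogisticRisk D).norm_sub_lt_of_lt_on_sphere (lt_min hr hη)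
        (hAs n hn D hD) (hmle βstar)).le.trans (min_le_right _ _)
    · by_contra! hcon
      obtain ⟨b, hb, hbr⟩ := (hghat n ω.1).exists_norm_sub_lt hcB (lt_min hr hη)
        (hAs n hn ω.1 hcon.1)
      obtain ⟨b', hb', hbr'⟩ := (hgtilde m ω.2).exists_norm_sub_lt hcB hr
        (hA's m hm ω.2 hcon.2)
      have h1 := hrisk (x := b) (by rw [dist_eq_norm]; exact hbr.trans_le (min_le_left _ _))
      have h2 := hrisk (x := b') (by rw [dist_eq_norm]; exact hbr')
      rw [Set.mem_ofPred_eq, hb, hb', classUtility] at hω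
      rw [dist_comm, Real.dist_eq] at h1
      rw [Real.dist_eq] at h2
      linarith [abs_sub_le (zeroOneRisk (logisticLaw PX βstar) (linearScore b'))
        (zeroOneRisk (logisticLaw PX βstar) (linearScore βstar))
        (zeroOneRisk (logisticLaw PX βstar) (linearScore b))]
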